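/- All sets are finite. A coherent configuration $\mathcal X=(\Omega,S)$ is a partition $S$ of $\Omega\times\Omega$ such that the diagonal $1_\Omega$ is a union of elements of $S$, the transpose $s^*$ of every $s\in S$ belongs to $S$, and for all $r,s,t\in S$ the number $c_{rs}^t=|\{\gamma\in\Omega : (\alpha,\gamma)\in r,\ (\gamma,\beta)\in s\}|$ does not depend on the choice of $(\alpha,\beta)\in t$. The elements of $S$ are the basis relations, their unions are the relations of $\mathcal X$. A coherent configuration is smaller than or equal to another one on the same set if all its relations are relations of the other. The coherent configuration $\operatorname{inv}(G)$ of a permutation group $G\le\operatorname{Sym}(\Omega)$ has the orbits of $G$ on $\Omega\times\Omega$ as basis relations. An algebraic isomorphism from $\mathcal X=(\Omega,S)$ to $\mathcal X'=(\Omega',S')$ is a bijection $\varphi:S\to S'$ with $c_{\varphi(r)\varphi(s)}^{\varphi(t)}=c_{rs}^t$ for all $r,s,t\in S$; it is extended to unions of basis relations in the obvious way. It is induced by an isomorphism if there is a bijection $f:\Omega\to\Omega'$ with $s^f=\varphi(s)$ for all $s\in S$. For $m\ge 1$, the $m$-extension of $\mathcal X$ is the smallest coherent configuration on $\Omega^m$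 among whose relations are all $s_1\otimes\cdots\otimes s_m=\{(\alpha,\beta)\in\Omega^m\times\Omega^m : (\alpha_i,\beta_i)\in s_i \text{ for all } i\}$ with $s_1,\dots,s_m\in S$, and the relation $1_{\operatorname{Diag}(\Omega^m)}=\{(\delta,\delta):\delta=(\alpha,\dots,\alpha),\ \alpha\in\Omega\}$. An algebraic isomorphism $\varphi$ from $\mathcal X$ to $\mathcal X'$ is $m$-dimensional if there is an algebraic isomorphism $\psi$ from the $m$-extension of $\mathcal X$ to the $m$-extension of $\mathcal X'$ such that $\psi(s_1\otimes\cdots\otimes s_m)=\varphi(s_1)\otimes\cdots\otimes\varphi(s_m)$ for all $s_1,\dots,s_m\in S$ and $\psi(1_{\operatorname{Diag}(\Omega^m)})=1_{\operatorname{Diag}(\Omega'^m)}$. The separability number $s(\mathcal X)$ is the smallest positive integer $m$ such that every $m$-dimensional algebraic isomorphism from $\mathcal X$ to a coherent configuration is induced by an isomorphism. Theorem. Let $q$ be an odd prime power, let $G\le\operatorname{AGL}(2,q)$ be the group of all permutations $x\mapsto Ax+b$ of $\mathbb F_q^2$, where $b\in\mathbb F_q^2$ and $A$ is a monomial $2\times2$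 matrix over $\mathbb F_q$ (exactly one nonzero entry in every row and every column) with $\det A=\pm1$, and let $\mathcal X=\operatorname{inv}(G)$ be the Passman scheme of degree $q^2$. Then $s(\mathcal X)\le 3$. -/

import Mathlib

universe u v

/-- A coherent configuration on the point set `Ω`. The partition `S` of `Ω × Ω` into basis
relations is given by the equivalence relation `rel` on `Ω × Ω` whose classes are the elements
of `S`. -/
structure CoherentConfiguration (Ω : Type u) where
  /-- Two pairs are equivalent when they lie in the same basis relation. -/
  rel : Setoid (Ω × Ω)
  /-- The diagonal is a union of basis relations. -/
  diag : ∀ {a b c : Ω}, rel (a, a) (b, c) → b = c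
  /-- The transpose of a basis relation is a basis relation. -/
  transpose : ∀ {a b c d : Ω}, rel (a, b) (c, d) → rel (b, a) (d, c)
  /-- For the basis relations `r ∋ x` and `s ∋ y`, the number of `γ` with `(α, γ) ∈ r` and
  `(γ, β) ∈ s` depends only on the basis relation that contains `(α, β)`. -/
  coherent : ∀ x y p p' : Ω × Ω, rel p p' →
    {c : Ω | rel (p.1, c) x ∧ rel (c, p.2) y}.ncard =
      {c : Ω | rel (p'.1, c) x ∧ rel (c, p'.2) y}.ncard

namespace CoherentConfiguration

variable {Ω : Type u} {Ω' : Type v}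

/-- The set `S` of basis relations. -/
abbrev BasisRel (X : CoherentConfiguration Ω) : Type u := Quotient X.rel

/-- The basis relation `r(α, β)` containing `(α, β)`. -/
def r (X : CoherentConfiguration Ω) (a b : Ω) : X.BasisRel := Quotient.mk X.rel (a, b)

/-- A basis relation as a set of pairs. -/
def graph (X : CoherentConfiguration Ω) (s : X.BasisRel) : Set (Ω × Ω) :=
  {p | X.r p.1 p.2 = s}

/-- The relations of `X`: the unions of basis relations. -/
def IsRelation (X : CoherentConfiguration Ω) (R : Set (Ω × Ω)) : Prop :=
  ∃ T : Set X.BasisRel, R = ⋃ t ∈ T, X.graph t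

/-- `X ≤ Y` if every relation of `X` is a relation of `Y`. -/
instance : LE (CoherentConfiguration Ω) where
  le X Y := ∀ R, X.IsRelation R → Y.IsRelation R

theorem r_eq_iff (X : CoherentConfiguration Ω) (a b c d : Ω) :
    X.r a b = X.r c d ↔ X.rel (a, b) (c, d) :=
  Quotient.eq (r := X.rel)

theorem isRelation_iff (X : CoherentConfiguration Ω) (R : Set (Ω × Ω)) :
    X.IsRelation R ↔ ∀ p q, X.rel p q → p ∈ R → q ∈ R := by
  constructor
  · rintro ⟨T, rfl⟩ p q h hp
    simp only [Set.mem_iUnion, graph, Set.mem_ofPred_eq, exists_prop] at hp ⊢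
    obtain ⟨t, ht, rfl⟩ := hp
    exact ⟨_, ht, (X.r_eq_iff _ _ _ _).2 (X.rel.symm' h)⟩
  · intro h
    refine ⟨{t | ∃ p ∈ R, X.r p.1 p.2 = t}, ?_⟩
    ext q
    simp only [Set.mem_iUnion, graph, Set.mem_ofPred_eq, exists_prop]
    constructor
    · intro hq
      exact ⟨_, ⟨q, hq, rfl⟩, rfl⟩
    · rintro ⟨t, ⟨p, hp, rfl⟩, e⟩
      exact h p q (X.rel.symm' ((X.r_eq_iff _ _ _ _).1 e)) hp

/-- The intersection number `c_{rs}^t = |α r ∩ β s*|`, where `(α, β) ∈ t`. -/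
noncomputable def intersectionNumber (X : CoherentConfiguration Ω) (r s t : X.BasisRel) : ℕ :=
  Quotient.lift (fun p : Ω × Ω => {c : Ω | X.r p.1 c = r ∧ X.r c p.2 = s}.ncard)
    (by
      intro p p' h
      induction r using Quotient.inductionOn with | _ x
      induction s using Quotient.inductionOn with | _ y
      have := X.coherent x y p p' h
      have key : ∀ (a b : Ω) (z : Ω × Ω), X.r a b = Quotient.mk X.rel z ↔ X.rel (a, b) z :=
        fun a b z => X.r_eq_iff a b z.1 z.2
      simp only [key]
      exact this) t

/-- An algebraic isomorphism: a bijection between the sets of basis relations that preserves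
the intersection numbers. -/
structure AlgIso (X : CoherentConfiguration Ω) (X' : CoherentConfiguration Ω') where
  toEquiv : X.BasisRel ≃ X'.BasisRel
  map_intersectionNumber : ∀ r s t : X.BasisRel,
    X'.intersectionNumber (toEquiv r) (toEquiv s) (toEquiv t) = X.intersectionNumber r s t

/-- The map on relations induced by an algebraic isomorphism: the union of basis relations
`r ∪ s ∪ ⋯` is sent to `φ(r) ∪ φ(s) ∪ ⋯`. -/
def AlgIso.mapRel {X : CoherentConfiguration Ω} {X' : CoherentConfiguration Ω'}
    (φ : AlgIso X X') (R : Set (Ω × Ω)) : Set (Ω' × Ω') :=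
  ⋃ t ∈ {t : X.BasisRel | X.graph t ⊆ R}, X'.graph (φ.toEquiv t)

/-- The algebraic isomorphism `φ` is induced by the bijection `f`: every basis relation `s` is
mapped by `f` onto the basis relation `φ(s)`. Since `φ` is a bijection of the sets of basis
relations, such an `f` is an isomorphism of coherent configurations. -/
def AlgIso.IsInducedBy {X : CoherentConfiguration Ω} {X' : CoherentConfiguration Ω'}
    (φ : AlgIso X X') (f : Ω ≃ Ω') : Prop :=
  ∀ s : X.BasisRel, Prod.map f f '' X.graph s = X'.graph (φ.toEquiv s)

theorem rel_le_closure {T : Set (Set (Ω × Ω))} {Y : CoherentConfiguration Ω}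
    (hY : ∀ R ∈ T, Y.IsRelation R) :
    Y.rel ≤ sSup {e | ∃ Y : CoherentConfiguration Ω, (∀ R ∈ T, Y.IsRelation R) ∧ Y.rel = e} :=
  le_sSup ⟨Y, hY, rfl⟩

theorem closure_induction {T : Set (Set (Ω × Ω))} (e : Setoid (Ω × Ω))
    (h : ∀ Y : CoherentConfiguration Ω, (∀ R ∈ T, Y.IsRelation R) → Y.rel ≤ e) :
    sSup {e | ∃ Y : CoherentConfiguration Ω, (∀ R ∈ T, Y.IsRelation R) ∧ Y.rel = e} ≤ e := by
  apply sSup_le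
  rintro _ ⟨Y, hY, rfl⟩
  exact h Y hY

theorem coherent_of_le [Finite Ω] (Y : CoherentConfiguration Ω) (E : Setoid (Ω × Ω))
    (hE : Y.rel ≤ E) (x y p p' : Ω × Ω) (h : Y.rel p p') :
    {c : Ω | E (p.1, c) x ∧ E (c, p.2) y}.ncard =
      {c : Ω | E (p'.1, c) x ∧ E (c, p'.2) y}.ncard := by
  classical
  have := Fintype.ofFinite Ω
  have : Finite Y.BasisRel := Quotient.finite Y.rel
  have := Fintype.ofFinite Y.BasisRel
  have key : ∀ p : Ω × Ω, {c : Ω | E (p.1, c) x ∧ E (c, p.2) y}.ncard =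
      ∑ rs : Y.BasisRel × Y.BasisRel,
        if (∃ a b, Y.r a b = rs.1 ∧ E (a, b) x) ∧ (∃ a b, Y.r a b = rs.2 ∧ E (a, b) y) then
          Y.intersectionNumber rs.1 rs.2 (Y.r p.1 p.2) else 0 := by
    intro p
    rw [Set.ncard_eq_toFinset_card']
    rw [Finset.card_eq_sum_card_fiberwise (t := Finset.univ)
      (f := fun c => (Y.r p.1 c, Y.r c p.2)) (fun _ _ => Finset.mem_coe.2 (Finset.mem_univ _))]
    refine Finset.sum_congr rfl ?_
    rintro ⟨r, s⟩ -
    split_ifs with hrs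
    · obtain ⟨⟨a, b, hab, habx⟩, ⟨a', b', hab', haby⟩⟩ := hrs
      change _ = {c : Ω | Y.r p.1 c = r ∧ Y.r c p.2 = s}.ncard
      rw [Set.ncard_eq_toFinset_card']
      congr 1
      ext c
      simp only [Finset.mem_filter, Set.mem_toFinset, Set.mem_ofPred_eq, Prod.mk.injEq]
      constructor
      · exact fun h => h.2
      · rintro ⟨h1, h2⟩
        refine ⟨⟨?_, ?_⟩, h1, h2⟩
        · exact E.trans' (hE ((Y.r_eq_iff _ _ _ _).1 (h1.trans hab.symm))) habx
        · exact E.trans' (hE ((Y.r_eq_iff _ _ _ _).1 (h2.trans hab'.symm))) haby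
    · rw [Finset.card_eq_zero, Finset.filter_eq_empty_iff]
      intro c hc he
      simp only [Set.mem_toFinset, Set.mem_ofPred_eq] at hc
      simp only [Prod.mk.injEq] at he
      exact hrs ⟨⟨_, _, he.1, hc.1⟩, ⟨_, _, he.2, hc.2⟩⟩
  rw [key p, key p', (Y.r_eq_iff _ _ _ _).2 (show Y.rel (p.1, p.2) (p'.1, p'.2) from h)]

/-- The coherent closure `WL(T)`: the smallest coherent configuration on `Ω` of which all
elements of `T` are relations. -/
def coherentClosure [Finite Ω] (T : Set (Set (Ω × Ω))) : CoherentConfiguration Ω where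
  rel := sSup {e | ∃ Y : CoherentConfiguration Ω, (∀ R ∈ T, Y.IsRelation R) ∧ Y.rel = e}
  diag := by
    intro a b c h
    have := closure_induction (T := T) (Setoid.ker fun p : Ω × Ω => p.1 = p.2) (by
      rintro Y - ⟨a, b⟩ ⟨c, d⟩ h
      refine propext ⟨?_, ?_⟩
      · intro e
        obtain rfl : a = b := e
        exact Y.diag h
      · intro e
        obtain rfl : c = d := e
        exact Y.diag (Y.rel.symm' h)) h
    exact (show (a = a) = (b = c) from this).mp rfl
  transpose := by
    intro a b c d h
    exact closure_induction (T := T) (Setoid.comap Prod.swap (sSup _))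
      (fun Y hY _ _ h => rel_le_closure hY (Y.transpose h)) h
  coherent := by
    intro x y p p' h
    exact closure_induction (T := T)
      (Setoid.ker fun p : Ω × Ω => {c : Ω | (sSup _ : Setoid (Ω × Ω)) (p.1, c) x ∧
        (sSup _ : Setoid (Ω × Ω)) (c, p.2) y}.ncard)
      (fun Y hY p p' h => coherent_of_le Y _ (rel_le_closure hY) x y p p' h) h

theorem coherentClosure_isLeast [Finite Ω] (T : Set (Set (Ω × Ω))) :
    IsLeast {Y : CoherentConfiguration Ω | ∀ R ∈ T, Y.IsRelation R} (coherentClosure T) := by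
  constructor
  · intro R hR
    rw [isRelation_iff]
    intro p q h
    have := closure_induction (T := T) (Setoid.ker fun p => p ∈ R) (by
      intro Y hY p q h
      exact propext ⟨(Y.isRelation_iff R).1 (hY R hR) p q h,
        (Y.isRelation_iff R).1 (hY R hR) q p (Y.rel.symm' h)⟩) h
    exact (show (p ∈ R) = (q ∈ R) from this).mp
  · intro Y hY R hR
    rw [isRelation_iff] at hR ⊢
    exact fun p q h => hR p q (rel_le_closure hY h)

/-- The basis relation `s₁ ⊗ ⋯ ⊗ sₘ` of the Cartesian `m`-power of `X`. -/
def tensor (X : CoherentConfiguration Ω) {m : ℕ} (s : Fin m → X.BasisRel) :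
    Set ((Fin m → Ω) × (Fin m → Ω)) :=
  {p | ∀ i, (p.1 i, p.2 i) ∈ X.graph (s i)}

/-- The relation `1_Δ` on `Ω^m`, where `Δ = Diag(Ω^m)`. -/
def diagRel (Ω : Type u) (m : ℕ) : Set ((Fin m → Ω) × (Fin m → Ω)) :=
  {p | p.1 = p.2 ∧ ∃ a : Ω, ∀ i, p.1 i = a}

/-- The `m`-extension of `X`: the smallest coherent configuration on `Ω^m` that contains the
Cartesian `m`-power of `X` and for which `Diag(Ω^m)` is a union of fibers. -/
def mExtension [Finite Ω] (X : CoherentConfiguration Ω) (m : ℕ) :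
    CoherentConfiguration (Fin m → Ω) :=
  coherentClosure (Set.range (X.tensor (m := m)) ∪ {diagRel Ω m})

/-- The algebraic isomorphism `φ` is `m`-dimensional: it extends to an algebraic isomorphism `ψ`
of the `m`-extensions that takes `Diag(Ω^m)` to `Diag(Ω'^m)`. That `ψ` extends `φ` means that on
the Cartesian `m`-power of `X` it is `s₁ ⊗ ⋯ ⊗ sₘ ↦ φ(s₁) ⊗ ⋯ ⊗ φ(sₘ)`. -/
def AlgIso.IsMDimensional [Finite Ω] [Finite Ω'] {X : CoherentConfiguration Ω}
    {X' : CoherentConfiguration Ω'} (φ : AlgIso X X') (m : ℕ) : Prop :=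
  ∃ ψ : AlgIso (X.mExtension m) (X'.mExtension m),
    (∀ s : Fin m → X.BasisRel, ψ.mapRel (X.tensor s) = X'.tensor fun i => φ.toEquiv (s i)) ∧
      ψ.mapRel (diagRel Ω m) = diagRel Ω' m

/-- Every `m`-dimensional algebraic isomorphism from `X` to a coherent configuration is induced
by an isomorphism. -/
def IsMSeparable {Ω : Type u} [Finite Ω] (X : CoherentConfiguration Ω) (m : ℕ) : Prop :=
  ∀ (Ω' : Type u) [Finite Ω'] (X' : CoherentConfiguration Ω') (φ : AlgIso X X'),
    φ.IsMDimensional m → ∃ f : Ω ≃ Ω', φ.IsInducedBy f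

/-- The separability number `s(X)`: the smallest positive integer `m` for which every
`m`-dimensional algebraic isomorphism from `X` is induced by an isomorphism (`⊤` if there is
no such `m`). -/
noncomputable def separabilityNumber {Ω : Type u} [Finite Ω] (X : CoherentConfiguration Ω) : ℕ∞ :=
  ⨅ (m : ℕ) (_ : 1 ≤ m) (_ : X.IsMSeparable m), (m : ℕ∞)

/-- The coherent configuration `inv(G)` of a permutation group `G`: the basis relations are the
orbits of `G` on `Ω × Ω`. -/
def inv (G : Subgroup (Equiv.Perm Ω)) : CoherentConfiguration Ω where
  rel := MulAction.orbitRel G (Ω × Ω)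
  diag := by
    rintro a b c h
    obtain ⟨g, hg⟩ := MulAction.orbitRel_apply.1 h
    obtain ⟨h1, h2⟩ := Prod.mk.inj hg
    exact MulAction.injective g (h1.trans h2.symm)
  transpose := by
    rintro a b c d h
    obtain ⟨g, hg⟩ := MulAction.orbitRel_apply.1 h
    obtain ⟨h1, h2⟩ := Prod.mk.inj hg
    exact MulAction.orbitRel_apply.2 ⟨g, Prod.ext h2 h1⟩
  coherent := by
    rintro x y p p' h
    obtain ⟨g, rfl⟩ := MulAction.orbitRel_apply.1 h
    have key : ∀ a b : Ω, ∀ z : Ω × Ω, MulAction.orbitRel G (Ω × Ω) (g • a, g • b) z ↔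
        MulAction.orbitRel G (Ω × Ω) (a, b) z := by
      intro a b z
      rw [MulAction.orbitRel_apply, MulAction.orbitRel_apply]
      change g • (a, b) ∈ MulAction.orbit G z ↔ _
      rw [← MulAction.orbit_eq_iff, MulAction.orbit_smul, MulAction.orbit_eq_iff]
    rw [← Set.ncard_image_of_injective {c : Ω | MulAction.orbitRel G (Ω × Ω) (p'.1, c) x ∧
        MulAction.orbitRel G (Ω × Ω) (c, p'.2) y} (MulAction.injective g)]
    congr 1
    ext c
    obtain ⟨c, rfl⟩ := MulAction.surjective g c
    rw [(MulAction.injective g).mem_set_image]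
    exact and_congr (key _ _ _) (key _ _ _)

end CoherentConfiguration

/-- A matrix is monomial if every row and every column has exactly one nonzero entry. -/
def Matrix.IsMonomial {n F : Type*} [Zero F] (A : Matrix n n F) : Prop :=
  (∀ i, ∃! j, A i j ≠ 0) ∧ ∀ j, ∃! i, A i j ≠ 0

theorem Matrix.isMonomial_fin_two_iff {F : Type*} [Zero F] (A : Matrix (Fin 2) (Fin 2) F) :
    A.IsMonomial ↔ (A 0 0 ≠ 0 ∧ A 0 1 = 0 ∧ A 1 0 = 0 ∧ A 1 1 ≠ 0) ∨
      (A 0 0 = 0 ∧ A 0 1 ≠ 0 ∧ A 1 0 ≠ 0 ∧ A 1 1 = 0) := by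
  simp only [Matrix.IsMonomial, ExistsUnique, Fin.forall_fin_two, Fin.exists_fin_two]
  by_cases h1 : A 0 0 = 0 <;> by_cases h2 : A 0 1 = 0 <;> by_cases h3 : A 1 0 = 0 <;>
    by_cases h4 : A 1 1 = 0 <;> simp [h1, h2, h3, h4]

/-- The group of the permutations `x ↦ A x + b` of `F²`, where `A` is a monomial matrix of
determinant `±1`. -/
def passmanGroup (F : Type u) [Field F] : Subgroup (Equiv.Perm (Fin 2 → F)) where
  carrier := {g | ∃ (A : Matrix (Fin 2) (Fin 2) F) (b : Fin 2 → F),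
    A.IsMonomial ∧ (A.det = 1 ∨ A.det = -1) ∧ ∀ x, g x = A.mulVec x + b}
  one_mem' := by
    refine ⟨1, 0, ?_, by simp, by simp⟩
    rw [Matrix.isMonomial_fin_two_iff]
    simp
  mul_mem' := by
    rintro g h ⟨A, b, hA, hdA, hg⟩ ⟨B, c, hB, hdB, hh⟩
    refine ⟨A * B, A.mulVec c + b, ?_, ?_, ?_⟩
    · rw [Matrix.isMonomial_fin_two_iff] at hA hB ⊢
      simp only [Matrix.mul_apply, Fin.sum_univ_two]
      rcases hA with ⟨h1, h2, h3, h4⟩ | ⟨h1, h2, h3, h4⟩ <;>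
        rcases hB with ⟨k1, k2, k3, k4⟩ | ⟨k1, k2, k3, k4⟩ <;> simp [*]
    · rw [Matrix.det_mul]
      rcases hdA with h | h <;> rcases hdB with k | k <;> simp [h, k]
    · intro x
      rw [Equiv.Perm.mul_apply, hg, hh, Matrix.mulVec_add, Matrix.mulVec_mulVec, add_assoc]
  inv_mem' := by
    rintro g ⟨A, b, hA, hdA, hg⟩
    have hu : IsUnit A.det := by rcases hdA with h | h <;> simp [h]
    refine ⟨A⁻¹, -A⁻¹.mulVec b, ?_, ?_, ?_⟩
    · rw [Matrix.isMonomial_fin_two_iff] at hA ⊢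
      rw [Matrix.inv_def, Matrix.adjugate_fin_two]
      have hu' : Ring.inverse A.det ≠ 0 := by
        rw [Ring.inverse_eq_inv']
        exact inv_ne_zero hu.ne_zero
      rcases hA with ⟨h1, h2, h3, h4⟩ | ⟨h1, h2, h3, h4⟩ <;> simp [*] <;> exact hu.ne_zero
    · rw [Matrix.det_nonsing_inv, Ring.inverse_eq_inv']
      rcases hdA with h | h <;> simp [h]
    · intro x
      rw [Equiv.Perm.inv_eq_iff_eq, hg, ← sub_eq_add_neg, ← Matrix.mulVec_sub,
        Matrix.mulVec_mulVec, Matrix.mul_nonsing_inv _ hu, Matrix.one_mulVec, sub_add_cancel]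

/-- The Passman scheme of degree `q²`, where `q` is the order of the finite field `F` of odd
characteristic. -/
def passmanScheme (F : Type u) [Field F] : CoherentConfiguration (Fin 2 → F) :=
  CoherentConfiguration.inv (passmanGroup F)

/-!
Let `Y` be a coherent configuration above the Passman scheme in which `(0, 0)` and `(1, 0)` are
fibers. The group preserves `(x₀ - y₀)² (x₁ - y₁)²`, so the fiber of `x` determines `x₀² x₁²` and
`(x₀ - 1)² x₁²`. Joining `x` to points with which it shares a coordinate, one recovers `x₀` and
`x₁²` from the fiber, and then `x` from its basis relation with `(0, 1)`: the point `(0, 1)` is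
regular. The `3`-extension induces such a configuration on the triples `((0, 0), (1, 0), x)`, and
following the regular point through an algebraic isomorphism of the `3`-extensions yields the
required bijection of the points.
-/

namespace CoherentConfiguration

section AlgIso

variable {Ω : Type u} {Ω' : Type v} {X : CoherentConfiguration Ω} {X' : CoherentConfiguration Ω'}

theorem exists_r_eq (X : CoherentConfiguration Ω) (s : X.BasisRel) : ∃ a b, X.r a b = s := by
  obtain ⟨⟨a, b⟩, h⟩ := Quotient.exists_rep s
  exact ⟨a, b, h⟩

theorem r_swap {a b c d : Ω} (h : X.r a b = X.r c d) : X.r b a = X.r d c :=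
  (X.r_eq_iff _ _ _ _).2 (X.transpose ((X.r_eq_iff _ _ _ _).1 h))

theorem eq_of_r_self_eq {a b c : Ω} (h : X.r a a = X.r b c) : b = c :=
  X.diag ((X.r_eq_iff _ _ _ _).1 h)

theorem intersectionNumber_r (X : CoherentConfiguration Ω) (s t : X.BasisRel) (a b : Ω) :
    X.intersectionNumber s t (X.r a b) = {c : Ω | X.r a c = s ∧ X.r c b = t}.ncard :=
  rfl

theorem intersectionNumber_r_ne_zero_iff [Finite Ω] {s t : X.BasisRel} {a b : Ω} :
    X.intersectionNumber s t (X.r a b) ≠ 0 ↔ ∃ c, X.r a c = s ∧ X.r c b = t := by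
  rw [intersectionNumber_r, ← Nat.pos_iff_ne_zero, Set.ncard_pos]
  rfl

namespace AlgIso

/-- The identity algebraic isomorphism. -/
def refl (X : CoherentConfiguration Ω) : AlgIso X X where
  toEquiv := Equiv.refl _
  map_intersectionNumber _ _ _ := rfl

/-- The inverse of an algebraic isomorphism. -/
def symm (φ : AlgIso X X') : AlgIso X' X where
  toEquiv := φ.toEquiv.symm
  map_intersectionNumber r s t := by
    simp only [← φ.map_intersectionNumber, Equiv.apply_symm_apply]

theorem symm_map_r {φ : AlgIso X X'} {a b : Ω} {a' b' : Ω'} :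
    φ.symm.toEquiv (X'.r a' b') = X.r a b ↔ φ.toEquiv (X.r a b) = X'.r a' b' :=
  φ.toEquiv.symm_apply_eq.trans eq_comm

variable [Finite Ω] [Finite Ω']

theorem exists_map_r (φ : AlgIso X X') {a b : Ω} {a' b' : Ω'}
    (h : φ.toEquiv (X.r a b) = X'.r a' b') (c : Ω) :
    ∃ c', φ.toEquiv (X.r a c) = X'.r a' c' ∧ φ.toEquiv (X.r c b) = X'.r c' b' := by
  have hc : X.intersectionNumber (X.r a c) (X.r c b) (X.r a b) ≠ 0 :=
    intersectionNumber_r_ne_zero_iff.2 ⟨c, rfl, rfl⟩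
  rw [← φ.map_intersectionNumber, h, intersectionNumber_r_ne_zero_iff] at hc
  obtain ⟨c', hac, hcb⟩ := hc
  exact ⟨c', hac.symm, hcb.symm⟩

theorem exists_comap_r (φ : AlgIso X X') {a b : Ω} {a' b' : Ω'}
    (h : φ.toEquiv (X.r a b) = X'.r a' b') (c' : Ω') :
    ∃ c, φ.toEquiv (X.r a c) = X'.r a' c' ∧ φ.toEquiv (X.r c b) = X'.r c' b' := by
  simpa only [symm_map_r] using φ.symm.exists_map_r (symm_map_r.2 h) c'

theorem eq_of_map_r_eq_self (φ : AlgIso X X') {a b : Ω} {a' : Ω'}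
    (h : φ.toEquiv (X.r a b) = X'.r a' a') : a = b := by
  obtain ⟨c', hac, hcb⟩ := φ.exists_map_r h a
  obtain rfl : c' = a' := eq_of_r_self_eq (h.symm.trans hcb)
  exact eq_of_r_self_eq (φ.toEquiv.injective (hac.trans h.symm))

theorem eq_of_map_r_self_eq (φ : AlgIso X X') {a : Ω} {a' b' : Ω'}
    (h : φ.toEquiv (X.r a a) = X'.r a' b') : a' = b' :=
  φ.symm.eq_of_map_r_eq_self (symm_map_r.2 h)

theorem injective_of_map_r (φ : AlgIso X X') {f : Ω → Ω'}
    (hf : ∀ x y, φ.toEquiv (X.r x y) = X'.r (f x) (f y)) : Function.Injective f := by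
  intro x y hxy
  refine φ.eq_of_map_r_eq_self (a' := f y) ?_
  rw [hf, hxy]

theorem surjective_of_map_r (φ : AlgIso X X') {f : Ω → Ω'}
    (hf : ∀ x y, φ.toEquiv (X.r x y) = X'.r (f x) (f y)) : Function.Surjective f := by
  intro x'
  obtain ⟨a, -, -⟩ := X.exists_r_eq (φ.toEquiv.symm (X'.r x' x'))
  obtain ⟨c, hac, hca⟩ := φ.exists_comap_r (hf a a) x'
  -- `f` maps the neighbours of `a` of the type of `c` into equally many neighbours of `f a`.
  set N := {d | X.r a d = X.r a c ∧ X.r d a = X.r c a}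
  set N' := {d' | X'.r (f a) d' = X'.r (f a) x' ∧ X'.r d' (f a) = X'.r x' (f a)}
  have hcard : N'.ncard = N.ncard := by
    rw [← intersectionNumber_r, ← intersectionNumber_r, ← φ.map_intersectionNumber, hac, hca, hf]
  have hmaps : f '' N ⊆ N' := by
    rintro _ ⟨d, ⟨had, hda⟩, rfl⟩
    exact ⟨by rw [← hf, had, hac], by rw [← hf, hda, hca]⟩
  have himage : f '' N = N' := Set.eq_of_subset_of_ncard_le hmaps
    (by rw [hcard, Set.ncard_image_of_injective _ (φ.injective_of_map_r hf)])
  obtain ⟨d, -, hd⟩ : x' ∈ f '' N := himage ▸ ⟨rfl, rfl⟩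
  exact ⟨d, hd⟩

theorem exists_isInducedBy_of_map_r (φ : AlgIso X X') {f : Ω → Ω'}
    (hf : ∀ x y, φ.toEquiv (X.r x y) = X'.r (f x) (f y)) : ∃ e : Ω ≃ Ω', φ.IsInducedBy e := by
  refine ⟨Equiv.ofBijective f ⟨φ.injective_of_map_r hf, φ.surjective_of_map_r hf⟩, fun s => ?_⟩
  ext ⟨x', y'⟩
  obtain ⟨x, rfl⟩ := φ.surjective_of_map_r hf x'
  obtain ⟨y, rfl⟩ := φ.surjective_of_map_r hf y'
  have hmem : (f x, f y) ∈ Prod.map f f '' X.graph s ↔ (x, y) ∈ X.graph s :=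
    ((φ.injective_of_map_r hf).prodMap (φ.injective_of_map_r hf)).mem_set_image (a := (x, y))
  refine hmem.trans ?_
  simp only [graph, Set.mem_ofPred_eq, ← hf, φ.toEquiv.apply_eq_iff_eq]

theorem exists_map_r_eq_of_determined {ι : Type*} (φ : AlgIso X X') (c : Ω) (p : ι → Ω)
    (hp : ∀ i x, X.r c x = X.r c (p i) → x = p i) :
    ∃ p' : ι → Ω', ∀ i j, φ.toEquiv (X.r (p i) (p j)) = X'.r (p' i) (p' j) := by
  obtain ⟨c', d', hc⟩ := X'.exists_r_eq (φ.toEquiv (X.r c c))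
  obtain rfl := φ.eq_of_map_r_self_eq hc.symm
  choose p' hp' _ using fun i => φ.exists_map_r hc.symm (p i)
  have hunique : ∀ i x', φ.toEquiv (X.r c (p i)) = X'.r c' x' → x' = p' i := by
    intro i x' h
    obtain ⟨x, hcx, hxp⟩ := φ.exists_comap_r (hp' i) x'
    obtain rfl := hp i x (φ.toEquiv.injective (hcx.trans h.symm))
    exact φ.eq_of_map_r_self_eq hxp
  refine ⟨p', fun i j => ?_⟩
  obtain ⟨x', hci, hij⟩ := φ.exists_map_r (hp' j) (p i)
  rwa [hunique i x' hci] at hij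

end AlgIso

end AlgIso

section Fibers

variable {Ω : Type u} {X Y : CoherentConfiguration Ω}

theorem le_iff_r_eq : X ≤ Y ↔ ∀ a b c d, Y.r a b = Y.r c d → X.r a b = X.r c d := by
  constructor
  · intro h a b c d hr
    have hgraph : X.IsRelation (X.graph (X.r c d)) := ⟨{X.r c d}, by simp⟩
    exact (Y.isRelation_iff _).1 (h _ hgraph) (c, d) (a, b) ((Y.r_eq_iff _ _ _ _).1 hr.symm) rfl
  · intro h R hR
    rw [isRelation_iff] at hR ⊢
    exact fun p q hpq =>
      hR p q ((X.r_eq_iff _ _ _ _).1 (h _ _ _ _ ((Y.r_eq_iff _ _ _ _).2 hpq)))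

/-- A point is fixed if its singleton is a fiber. -/
def IsFixedPoint (X : CoherentConfiguration Ω) (a : Ω) : Prop :=
  ∀ b, X.r a a = X.r b b → a = b

/-- A point is regular if it has at most one neighbour in every basis relation. -/
def IsRegularPoint (X : CoherentConfiguration Ω) (a : Ω) : Prop :=
  Function.Injective (X.r a)

variable [Finite Ω]

theorem exists_triangle {a b c d : Ω} (h : X.r a b = X.r c d) (u : Ω) :
    ∃ v, X.r a u = X.r c v ∧ X.r u b = X.r v d :=
  (AlgIso.refl X).exists_map_r h u

theorem r_self_left {a b c d : Ω} (h : X.r a b = X.r c d) : X.r a a = X.r c c := by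
  obtain ⟨v, hv, -⟩ := exists_triangle h a
  rwa [← eq_of_r_self_eq hv] at hv

theorem r_self_right {a b c d : Ω} (h : X.r a b = X.r c d) : X.r b b = X.r d d :=
  r_self_left (r_swap h)

theorem IsFixedPoint.r_eq {a x y : Ω} (ha : X.IsFixedPoint a) (h : X.r x x = X.r y y) :
    X.r a x = X.r a y := by
  obtain ⟨v, -, hv⟩ := exists_triangle h a
  rwa [← ha v (r_self_left hv)] at hv

end Fibers

section Comap

variable {Ω : Type u} {Ω' : Type v}

/-- The coherent configuration induced on the domain of an embedding `f`. The condition on `f`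
says that a basis relation joining two points of the range of `f` joins no point of the range to
a point outside it; it holds when the range is a class of an equivalence relation that is a
relation of `Z`. -/
def comap (Z : CoherentConfiguration Ω') (f : Ω ↪ Ω')
    (hf : ∀ a b c d, Z.r (f a) d = Z.r (f b) (f c) → d ∈ Set.range f) :
    CoherentConfiguration Ω where
  rel := Z.rel.comap (Prod.map f f)
  diag h := f.injective (Z.diag h)
  transpose h := Z.transpose h
  coherent x y p p' h := by
    have ncard_eq (q : Ω × Ω) :
        {c | Z.rel (f q.1, f c) (Prod.map f f x) ∧ Z.rel (f c, f q.2) (Prod.map f f y)}.ncard =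
          {d | Z.rel (f q.1, d) (Prod.map f f x) ∧ Z.rel (d, f q.2) (Prod.map f f y)}.ncard := by
      rw [← Set.ncard_image_of_injective _ f.injective]
      congr 1
      ext d
      constructor
      · rintro ⟨c, hc, rfl⟩
        exact hc
      · intro hd
        obtain ⟨c, rfl⟩ := hf _ _ _ _ ((Z.r_eq_iff _ _ _ _).2 hd.1)
        exact ⟨c, hd, rfl⟩
    exact (ncard_eq p).trans ((Z.coherent _ _ _ _ h).trans (ncard_eq p').symm)

theorem comap_r_eq_iff {Z : CoherentConfiguration Ω'} {f : Ω ↪ Ω'}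
    {hf : ∀ a b c d, Z.r (f a) d = Z.r (f b) (f c) → d ∈ Set.range f} {a b c d : Ω} :
    (Z.comap f hf).r a b = (Z.comap f hf).r c d ↔ Z.r (f a) (f b) = Z.r (f c) (f d) := by
  rw [r_eq_iff, r_eq_iff]
  rfl

end Comap

section Extension

variable {Ω : Type u} [Finite Ω] {X : CoherentConfiguration Ω} {m : ℕ}

theorem r_apply_of_mExtension_r {α β γ δ : Fin m → Ω}
    (h : (X.mExtension m).r α β = (X.mExtension m).r γ δ) (i : Fin m) :
    X.r (α i) (β i) = X.r (γ i) (δ i) := by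
  have htensor : (X.mExtension m).IsRelation (X.tensor fun i => X.r (γ i) (δ i)) :=
    (coherentClosure_isLeast _).1 _ (Or.inl ⟨_, rfl⟩)
  exact (isRelation_iff _ _).1 htensor (γ, δ) (α, β) ((r_eq_iff _ _ _ _ _).1 h.symm)
    (fun _ => rfl) i

theorem exists_eq_const_of_mExtension_r {a : Ω} {α β : Fin m → Ω}
    (h : (X.mExtension m).r (fun _ => a) (fun _ => a) = (X.mExtension m).r α β) :
    ∃ b, ∀ i, α i = b := by
  have hdiag : (X.mExtension m).IsRelation (diagRel Ω m) :=
    (coherentClosure_isLeast _).1 _ (Or.inr rfl)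
  exact ((isRelation_iff _ _).1 hdiag _ (α, β) ((r_eq_iff _ _ _ _ _).1 h) ⟨rfl, a, fun _ => rfl⟩).2

theorem r_entries_of_mExtension_r_self {α β : Fin m → Ω}
    (h : (X.mExtension m).r α α = (X.mExtension m).r β β) (i j : Fin m) :
    X.r (α i) (α j) = X.r (β i) (β j) := by
  -- The diagonal point `(α i, …, α i)` is matched with a diagonal point, which is `(β i, …, β i)`.
  obtain ⟨δ, hαδ, hδα⟩ := exists_triangle h fun _ => α i
  obtain ⟨b, hb⟩ := exists_eq_const_of_mExtension_r (r_self_left hδα)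
  have hi : β i = δ i := eq_of_r_self_eq (r_apply_of_mExtension_r hαδ i)
  have hj : X.r (α i) (α j) = X.r (δ j) (β j) := r_apply_of_mExtension_r hδα j
  rwa [hb j, ← hb i, ← hi] at hj

theorem eq_update_of_mExtension_r {α γ : Fin m → Ω} {i : Fin m} {x y z : Ω}
    (h : (X.mExtension m).r (Function.update α i x) γ =
      (X.mExtension m).r (Function.update α i y) (Function.update α i z)) :
    γ = Function.update α i (γ i) := by
  refine Function.eq_update_iff.2 ⟨rfl, fun j hj => ?_⟩
  have hr := r_apply_of_mExtension_r h j
  simp only [Function.update_of_ne hj] at hr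
  exact (eq_of_r_self_eq hr.symm).symm

/-- The coherent configuration that the `m`-extension induces on the tuples differing from `α` at
most in the `i`-th entry, a tuple being identified with its `i`-th entry. It plays the role of the
extension of `X` with respect to the points `α j`, `j ≠ i`. -/
def tupleSection (X : CoherentConfiguration Ω) (α : Fin m → Ω) (i : Fin m) :
    CoherentConfiguration Ω :=
  (X.mExtension m).comap ⟨Function.update α i, Function.update_injective α i⟩
    fun _ _ _ d h => ⟨d i, (eq_update_of_mExtension_r h).symm⟩

theorem tupleSection_r_eq_iff {α : Fin m → Ω} {i : Fin m} {a b c d : Ω} :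
    (X.tupleSection α i).r a b = (X.tupleSection α i).r c d ↔
      (X.mExtension m).r (Function.update α i a) (Function.update α i b) =
        (X.mExtension m).r (Function.update α i c) (Function.update α i d) :=
  comap_r_eq_iff

theorem le_tupleSection (X : CoherentConfiguration Ω) (α : Fin m → Ω) (i : Fin m) :
    X ≤ X.tupleSection α i :=
  le_iff_r_eq.2 fun a b c d h => by
    simpa only [Function.update_self] using r_apply_of_mExtension_r (tupleSection_r_eq_iff.1 h) i

theorem tupleSection_isFixedPoint (X : CoherentConfiguration Ω) (α : Fin m → Ω) {i j : Fin m}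
    (hj : j ≠ i) : (X.tupleSection α i).IsFixedPoint (α j) := by
  intro b h
  have hr := r_entries_of_mExtension_r_self (tupleSection_r_eq_iff.1 h) i j
  simp only [Function.update_self, Function.update_of_ne hj] at hr
  exact (eq_of_r_self_eq hr).symm

theorem AlgIso.map_r_apply_of_tensor {Ω' : Type v} [Finite Ω'] {X' : CoherentConfiguration Ω'}
    {φ : AlgIso X X'} {ψ : AlgIso (X.mExtension m) (X'.mExtension m)}
    (hψ : ∀ s : Fin m → X.BasisRel, ψ.mapRel (X.tensor s) = X'.tensor fun i => φ.toEquiv (s i))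
    {α β : Fin m → Ω} {α' β' : Fin m → Ω'}
    (h : ψ.toEquiv ((X.mExtension m).r α β) = (X'.mExtension m).r α' β') (i : Fin m) :
    φ.toEquiv (X.r (α i) (β i)) = X'.r (α' i) (β' i) := by
  have hmem : (α', β') ∈ ψ.mapRel (X.tensor fun i => X.r (α i) (β i)) := by
    simp only [AlgIso.mapRel, Set.mem_iUnion]
    exact ⟨(X.mExtension m).r α β, fun _ hp => r_apply_of_mExtension_r hp, h.symm⟩
  rw [hψ] at hmem
  exact (hmem i).symm

theorem isMSeparable_of_isRegularPoint_tupleSection {α : Fin m → Ω} {i : Fin m}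
    (hα : (X.tupleSection α i).IsRegularPoint (α i)) : X.IsMSeparable m := by
  rintro Ω' _ X' φ ⟨ψ, hψ, -⟩
  have determined (x : Ω) (γ : Fin m → Ω)
      (h : (X.mExtension m).r α γ = (X.mExtension m).r α (Function.update α i x)) :
      γ = Function.update α i x := by
    have hupdate : (X.mExtension m).r (Function.update α i (α i)) γ =
        (X.mExtension m).r (Function.update α i (α i)) (Function.update α i x) := by
      rwa [Function.update_eq_self]
    have hγ := eq_update_of_mExtension_r hupdate
    rw [hγ] at hupdate
    rw [hγ, hα (tupleSection_r_eq_iff.2 hupdate)]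
  obtain ⟨g, hg⟩ := ψ.exists_map_r_eq_of_determined α (Function.update α i) determined
  refine φ.exists_isInducedBy_of_map_r (f := fun x => g x i) fun x y => ?_
  simpa only [Function.update_self] using AlgIso.map_r_apply_of_tensor hψ (hg x y) i

theorem isMSeparable_of_forall_isRegularPoint (α : Fin m → Ω) (i : Fin m)
    (h : ∀ Y : CoherentConfiguration Ω, X ≤ Y → (∀ j ≠ i, Y.IsFixedPoint (α j)) →
      Y.IsRegularPoint (α i)) : X.IsMSeparable m :=
  isMSeparable_of_isRegularPoint_tupleSection
    (h _ (X.le_tupleSection α i) fun _ => X.tupleSection_isFixedPoint α)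

theorem separabilityNumber_le_of_isMSeparable (hm : 1 ≤ m) (h : X.IsMSeparable m) :
    X.separabilityNumber ≤ m :=
  iInf_le_of_le m (iInf_le_of_le hm (iInf_le _ h))

end Extension

end CoherentConfiguration

theorem eq_of_sub_sq_eq_sub_sq {R : Type*} [CommRing R] [NoZeroDivisors R] {a b c d : R}
    (hcd : c ≠ d) (hc : (a - c) ^ 2 = (b - c) ^ 2) (hd : (a - d) ^ 2 = (b - d) ^ 2) : a = b := by
  by_contra hab
  have sum_eq : ∀ e, (a - e) ^ 2 = (b - e) ^ 2 → a + b = 2 * e := fun e he =>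
    mul_left_cancel₀ (sub_ne_zero.2 hab) (by linear_combination he)
  have htwo : (2 : R) = 0 := by
    have : (2 : R) * (c - d) = 0 := by linear_combination sum_eq d hd - sum_eq c hc
    exact (mul_eq_zero.1 this).resolve_right (sub_ne_zero.2 hcd)
  exact hab (by linear_combination sum_eq c hc + (c - b) * htwo)

theorem mulVec_mul_mulVec_sq_of_isMonomial {R : Type*} [CommRing R]
    {A : Matrix (Fin 2) (Fin 2) R} (hA : A.IsMonomial) (u : Fin 2 → R) :
    (A.mulVec u 0 * A.mulVec u 1) ^ 2 = A.det ^ 2 * (u 0 * u 1) ^ 2 := by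
  rw [Matrix.det_fin_two]
  simp only [Matrix.mulVec, dotProduct, Fin.sum_univ_two]
  rcases A.isMonomial_fin_two_iff.1 hA with ⟨-, h01, h10, -⟩ | ⟨h00, -, -, h11⟩
  · rw [h01, h10]
    ring
  · rw [h00, h11]
    ring

section Passman

open CoherentConfiguration

variable {F : Type u} [Field F]

theorem coord_sub_mul_sq_of_mem_passmanGroup {g : Equiv.Perm (Fin 2 → F)}
    (hg : g ∈ passmanGroup F) (x y : Fin 2 → F) :
    ((g x 0 - g y 0) * (g x 1 - g y 1)) ^ 2 = ((x 0 - y 0) * (x 1 - y 1)) ^ 2 := by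
  obtain ⟨A, b, hA, hdet, hg⟩ := hg
  have hdet_sq : A.det ^ 2 = 1 := sq_eq_one_iff.2 hdet
  have hsub : ∀ i, g x i - g y i = A.mulVec (x - y) i := by simp [hg, Matrix.mulVec_sub]
  rw [hsub, hsub, mulVec_mul_mulVec_sq_of_isMonomial hA, hdet_sq, one_mul, Pi.sub_apply,
    Pi.sub_apply]

variable {Y : CoherentConfiguration (Fin 2 → F)} {x y z w : Fin 2 → F}

theorem coord_sub_mul_sq_eq_of_r_eq (hY : passmanScheme F ≤ Y) (h : Y.r x y = Y.r z w) :
    ((x 0 - y 0) * (x 1 - y 1)) ^ 2 = ((z 0 - w 0) * (z 1 - w 1)) ^ 2 := by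
  obtain ⟨⟨g, hg⟩, hgzw⟩ :=
    MulAction.orbitRel_apply.1 ((r_eq_iff _ _ _ _ _).1 (le_iff_r_eq.1 hY _ _ _ _ h))
  obtain ⟨rfl, rfl⟩ : g z = x ∧ g w = y := Prod.mk.inj hgzw
  exact coord_sub_mul_sq_of_mem_passmanGroup hg z w

theorem fst_eq_or_snd_eq_of_r_eq (hY : passmanScheme F ≤ Y) (h : Y.r x y = Y.r z w)
    (hxy : x 0 = y 0 ∨ x 1 = y 1) : z 0 = w 0 ∨ z 1 = w 1 := by
  have hzero : (x 0 - y 0) * (x 1 - y 1) = 0 :=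
    mul_eq_zero.2 (hxy.imp sub_eq_zero.2 sub_eq_zero.2)
  have hsq := coord_sub_mul_sq_eq_of_r_eq hY h
  rw [hzero, zero_pow two_ne_zero] at hsq
  exact (mul_eq_zero.1 (sq_eq_zero_iff.1 hsq.symm)).imp sub_eq_zero.1 sub_eq_zero.1

variable [Finite F]

theorem coord_sub_mul_sq_eq_of_isFixedPoint (hY : passmanScheme F ≤ Y) {a : Fin 2 → F}
    (ha : Y.IsFixedPoint a) (h : Y.r x x = Y.r z z) :
    ((x 0 - a 0) * (x 1 - a 1)) ^ 2 = ((z 0 - a 0) * (z 1 - a 1)) ^ 2 :=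
  coord_sub_mul_sq_eq_of_r_eq hY (r_swap (ha.r_eq h))

/-- `Y` is at least the extension of the Passman scheme with respect to the points `(0, 0)` and
`(1, 0)`. -/
structure IsPassmanExtension (Y : CoherentConfiguration (Fin 2 → F)) : Prop where
  le : passmanScheme F ≤ Y
  isFixedPoint_zero_zero : Y.IsFixedPoint ![0, 0]
  isFixedPoint_one_zero : Y.IsFixedPoint ![1, 0]

namespace IsPassmanExtension

theorem fst_snd_sq_eq_of_r_self_eq (hY : IsPassmanExtension Y) (h : Y.r x x = Y.r z z) :
    x 0 ^ 2 * x 1 ^ 2 = z 0 ^ 2 * z 1 ^ 2 ∧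
      (x 0 - 1) ^ 2 * x 1 ^ 2 = (z 0 - 1) ^ 2 * z 1 ^ 2 := by
  have hsq₀ := coord_sub_mul_sq_eq_of_isFixedPoint hY.le hY.isFixedPoint_zero_zero h
  have hsq₁ := coord_sub_mul_sq_eq_of_isFixedPoint hY.le hY.isFixedPoint_one_zero h
  simpa only [Matrix.cons_val_zero, Matrix.cons_val_one, sub_zero, mul_pow]
    using And.intro hsq₀ hsq₁

theorem fst_eq_zero_and_snd_sq_eq_of_r_self_eq (hY : IsPassmanExtension Y)
    (h : Y.r x x = Y.r z z) (hx₀ : x 0 = 0) (hx₁ : x 1 ≠ 0) : z 0 = 0 ∧ x 1 ^ 2 = z 1 ^ 2 := by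
  obtain ⟨hsq₀, hsq₁⟩ := hY.fst_snd_sq_eq_of_r_self_eq h
  rw [hx₀] at hsq₀ hsq₁
  have hz₁ : z 1 ≠ 0 := fun hz => hx₁ (by simpa [hz] using hsq₁)
  have hz₀ : z 0 = 0 := by simpa [hz₁] using hsq₀.symm
  rw [hz₀] at hsq₁
  exact ⟨hz₀, by linear_combination hsq₁⟩

theorem snd_sq_eq_of_r_self_eq (hY : IsPassmanExtension Y) (h : Y.r x x = Y.r z z) :
    x 1 ^ 2 = z 1 ^ 2 := by
  obtain ⟨hsq₀, hsq₁⟩ := hY.fst_snd_sq_eq_of_r_self_eq h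
  rcases eq_or_ne (x 1) 0 with hx₁ | hx₁
  · have hz : z 0 * z 1 = 0 ∧ (z 0 - 1) * z 1 = 0 := by
      simpa [hx₁, eq_comm (a := (0 : F))] using And.intro hsq₀ hsq₁
    have hz₁ : z 1 = 0 := by linear_combination hz.1 - hz.2
    rw [hx₁, hz₁]
  rcases eq_or_ne (x 0) 0 with hx₀ | hx₀
  · exact (hY.fst_eq_zero_and_snd_sq_eq_of_r_self_eq h hx₀ hx₁).2
  -- Project `x` onto the second axis.
  obtain ⟨v, hxv, -⟩ := exists_triangle h ![0, x 1]
  obtain ⟨hv₀, hv₁⟩ := hY.fst_eq_zero_and_snd_sq_eq_of_r_self_eq (r_self_right hxv) rfl hx₁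
  have hz₀ : z 0 ≠ 0 := by
    intro hz
    simp [hz, hx₀, hx₁] at hsq₀
  have hzv : z 1 = v 1 :=
    (fst_eq_or_snd_eq_of_r_eq hY.le hxv (Or.inr rfl)).resolve_left (hv₀ ▸ hz₀)
  rw [hzv]
  exact hv₁

theorem fst_eq_of_r_self_eq_of_snd_ne_zero (hY : IsPassmanExtension Y)
    (h : Y.r x x = Y.r z z) (hx₁ : x 1 ≠ 0) : x 0 = z 0 := by
  obtain ⟨hsq₀, hsq₁⟩ := hY.fst_snd_sq_eq_of_r_self_eq h
  rw [← hY.snd_sq_eq_of_r_self_eq h] at hsq₀ hsq₁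
  refine eq_of_sub_sq_eq_sub_sq zero_ne_one ?_ (mul_right_cancel₀ (pow_ne_zero 2 hx₁) hsq₁)
  simpa only [sub_zero] using mul_right_cancel₀ (pow_ne_zero 2 hx₁) hsq₀

theorem fst_eq_of_r_self_eq (hY : IsPassmanExtension Y) (h : Y.r x x = Y.r z z) : x 0 = z 0 := by
  rcases eq_or_ne (x 1) 0 with hx₁ | hx₁
  · -- Replace `x` by a point above it, off the first axis.
    obtain ⟨v, hxv, -⟩ := exists_triangle h ![x 0, 1]
    have huv := r_self_right hxv
    have hv₀ : x 0 = v 0 :=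
      hY.fst_eq_of_r_self_eq_of_snd_ne_zero (x := ![x 0, 1]) huv one_ne_zero
    have hv₁ : 1 ^ 2 = v 1 ^ 2 := hY.snd_sq_eq_of_r_self_eq huv
    have hz₁ : 0 ^ 2 = z 1 ^ 2 := hx₁ ▸ hY.snd_sq_eq_of_r_self_eq h
    have hzv : z 1 ≠ v 1 := by
      intro hzv
      rw [hzv, ← hv₁] at hz₁
      simp at hz₁
    exact hv₀.trans ((fst_eq_or_snd_eq_of_r_eq hY.le hxv (Or.inl rfl)).resolve_right hzv).symm
  · exact hY.fst_eq_of_r_self_eq_of_snd_ne_zero h hx₁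

theorem eq_of_r_zero_one_eq (hY : IsPassmanExtension Y) (h : Y.r ![0, 1] x = Y.r ![0, 1] z)
    (hx₀ : x 0 ≠ 0) : x = z := by
  have hz₀ := hY.fst_eq_of_r_self_eq (r_self_right h)
  have hz₁ := hY.snd_sq_eq_of_r_self_eq (r_self_right h)
  have hsub_one : x 0 ^ 2 * (x 1 - 1) ^ 2 = x 0 ^ 2 * (z 1 - 1) ^ 2 := by
    have hsq := coord_sub_mul_sq_eq_of_r_eq hY.le (r_swap h)
    simpa only [Matrix.cons_val_zero, Matrix.cons_val_one, sub_zero, mul_pow, ← hz₀] using hsq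
  have hz₁' : x 1 = z 1 := eq_of_sub_sq_eq_sub_sq zero_ne_one (by simpa only [sub_zero] using hz₁)
    (mul_left_cancel₀ (pow_ne_zero 2 hx₀) hsub_one)
  exact funext (Fin.forall_fin_two.2 ⟨hz₀, hz₁'⟩)

theorem isRegularPoint_zero_one (hY : IsPassmanExtension Y) : Y.IsRegularPoint ![0, 1] := by
  intro x z h
  have hz₀ := hY.fst_eq_of_r_self_eq (r_self_right h)
  rcases eq_or_ne (x 0) 0 with hx₀ | hx₀
  · -- Replace `x` by the point `(1, x₁)`, off the second axis.
    obtain ⟨v, hv, hvx⟩ := exists_triangle h ![1, x 1]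
    obtain rfl := hY.eq_of_r_zero_one_eq hv one_ne_zero
    have hne : 1 ≠ z 0 := by
      rw [← hz₀, hx₀]
      exact one_ne_zero
    have hz₁ : x 1 = z 1 := (fst_eq_or_snd_eq_of_r_eq hY.le hvx (Or.inr rfl)).resolve_left hne
    exact funext (Fin.forall_fin_two.2 ⟨hz₀, hz₁⟩)
  · exact hY.eq_of_r_zero_one_eq h hx₀

end IsPassmanExtension

end Passman

theorem theorem1p4_general (F : Type u) [Field F] [Finite F] :
    (passmanScheme F).separabilityNumber ≤ 3 := by
  refine CoherentConfiguration.separabilityNumber_le_of_isMSeparable (m := 3) (by norm_num) ?_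
  refine CoherentConfiguration.isMSeparable_of_forall_isRegularPoint
    ![![0, 0], ![1, 0], ![0, 1]] 2 fun Y hY hfixed => ?_
  exact IsPassmanExtension.isRegularPoint_zero_one
    ⟨hY, hfixed 0 (by decide), hfixed 1 (by decide)⟩

theorem theorem1p4 (F : Type u) [Field F] [Finite F] (hF : Odd (Nat.card F)) :
    (passmanScheme F).separabilityNumber ≤ 3 :=
  theorem1p4_general F
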